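/- All paratopological groups (groups with a topology making multiplication jointly continuous) are assumed to satisfy the $T_0$ separation axiom. For a paratopological group $G$, let $G^\sharp$ be the topological group with the same underlying group and with the sets $U\cap U^{-1}$, $U$ a neighborhood of the identity $e$ in $G$, as a neighborhood base at $e$. The Raĭkov completion $\breve G$ of $G$ is the paratopological group whose underlying group is the Raĭkov completion $\varrho G^\sharp$ of $G^\sharp$ (the completion with respect to the two-sided uniformity) and in which the closures in $\varrho G^\sharp$ of the neighborhoods $U$ of $e$ in $G$ form a neighborhood base at the identity; it contains $G$ as a subgroup. Given a class $\mathcal C$ of continuous homomorphisms between paratopological groups, a paratopological group $H$ is called $\mathcal C$-complete if every homomorphism $h\colon X\to H$ in $\mathcal C$ extends to a continuous homomorphism $\breve X\to H$. The $\mathcal C$-completion $\mathcal C[G]$ of $G$ is the intersection of all $\mathcal C$-complete subgroups of $\breve G$ that contain $G$, with the subspace topology. A paratopological group $G$ is *projectively $\Psi$* if for every neighborhood $U$ of the identity in $G$ there is a continuous homomorphism $h\colon G\to Y$ to a Hausdorff paratopological group $Y$ of countable pseudocharacter (every point of $Y$ is a $G_\delta$-set) with $h^{-1}(e_Y)\subseteq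 U$. It is *$\omega$-balanced* if for every neighborhood $U$ of the identity there is a countable family $\mathcal V$ of neighborhoods of the identity such that for each $x\in G$ there is $V\in\mathcal V$ with $xVx^{-1}\subseteq U$. The *Hausdorff number* $Hs(G)$ of a Hausdorff paratopological group $G$ is the smallest cardinal $\kappa\ge 1$ such that for every neighborhood $U$ of the identity there is a family $\{V_\alpha\}_{\alpha\in\kappa}$ of neighborhoods of the identity with $\bigcap_{\alpha\in\kappa}V_\alpha V_\alpha^{-1}\subseteq U$. **Theorem.** Let $\mathcal C$ be any subclass of the class of continuous homomorphisms from pseudocompact topological groups to paratopological groups, and let $G$ be a paratopological group. 1. If $G$ is projectively $\Psi$, then $\mathcal C[G]$ is Hausdorff. 2. If $G$ is Hausdorff and $\omega$-balanced and satisfies $Hs(G)\le\omega$, then $\mathcal C[G]$ is $\omega$-balanced and Hausdorff, and $Hs(\mathcal C[G])\le\omega$. -/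

import Mathlib

open Filter Topology Uniformity Pointwise Set Cardinal

universe u v

/-- A `T₀` paratopological group: a group with a `T₀` topology and jointly continuous
multiplication. -/
class ParatopologicalGroup (G : Type u) [Group G] [TopologicalSpace G] : Prop
  extends ContinuousMul G, T0Space G

instance Subgroup.instParatopologicalGroup {G : Type u} [Group G] [TopologicalSpace G]
    [ParatopologicalGroup G] (H : Subgroup G) : ParatopologicalGroup H where
  toContinuousMul := inferInstanceAs (ContinuousMul H.toSubmonoid)
  toT0Space := inferInstance

/-! ### The Raĭkov completion of a topological group -/

section TwoSided

variable (H : Type u) [Group H] [TopologicalSpace H] [IsTopologicalGroup H]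

/-- The two-sided uniformity of a topological group: the join of the left and the right one. -/
abbrev twoSidedUniformSpace : UniformSpace H :=
  (IsTopologicalGroup.leftUniformSpace H ⊓ IsTopologicalGroup.rightUniformSpace H).replaceTopology
    (inf_idem _).symm

/-- The Raĭkov completion of a topological group: the (separated) completion of its two-sided
uniformity. -/
def TopRaikov : Type u := @UniformSpace.Completion H (twoSidedUniformSpace H)

namespace TopRaikov

attribute [local instance] twoSidedUniformSpace

instance : UniformSpace (TopRaikov H) := inferInstanceAs (UniformSpace (UniformSpace.Completion H))
instance : CompleteSpace (TopRaikov H) :=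
  inferInstanceAs (CompleteSpace (UniformSpace.Completion H))
instance : T0Space (TopRaikov H) := inferInstanceAs (T0Space (UniformSpace.Completion H))

variable {H}

/-- The canonical map of a topological group to its Raĭkov completion. -/
def of (x : H) : TopRaikov H := ((x : UniformSpace.Completion H))

theorem isDenseInducing_of : IsDenseInducing (of : H → TopRaikov H) :=
  UniformSpace.Completion.isDenseInducing_coe

theorem continuous_of : Continuous (of : H → TopRaikov H) := isDenseInducing_of.continuous

theorem isUniformInducing_of : IsUniformInducing (of : H → TopRaikov H) :=
  UniformSpace.Completion.isUniformInducing_coe H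

theorem uniformity_basis_aux {s : Set (H × H)} :
    s ∈ 𝓤 H ↔ ∃ W ∈ 𝓝 (1 : H), ∀ x y, x⁻¹ * y ∈ W → y * x⁻¹ ∈ W → (x, y) ∈ s := by
  change s ∈ comap (fun p : H × H => p.1⁻¹ * p.2) (𝓝 1) ⊓
    comap (fun p : H × H => p.2 * p.1⁻¹) (𝓝 1) ↔ _
  rw [mem_inf_iff_superset]
  constructor
  · rintro ⟨a, ⟨V, hV, hVa⟩, b, ⟨W, hW, hWb⟩, hs⟩
    exact ⟨V ∩ W, inter_mem hV hW, fun x y h1 h2 => hs ⟨hVa h1.1, hWb h2.2⟩⟩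
  · rintro ⟨W, hW, h⟩
    exact ⟨_, preimage_mem_comap hW, _, preimage_mem_comap hW, fun p hp => h p.1 p.2 hp.1 hp.2⟩

theorem cauchy_mul {F F' : Filter H} (hF : Cauchy F) (hF' : Cauchy F') :
    Cauchy (map (fun p : H × H => p.1 * p.2) (F ×ˢ F')) := by
  have := hF.1
  have := hF'.1
  refine ⟨inferInstance, ?_⟩
  intro s hs
  obtain ⟨W, hW, hWs⟩ := uniformity_basis_aux.1 hs
  obtain ⟨V, hV, hVW⟩ : ∃ V ∈ 𝓝 (1 : H), ∀ t ∈ V, ∀ r ∈ V, ∀ z ∈ V,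
      t * (r⁻¹ * z * r) ∈ W ∧ r * z * r⁻¹ * t ∈ W := by
    have h1 : Tendsto (fun p : H × H × H => p.1 * (p.2.1⁻¹ * p.2.2 * p.2.1))
        (𝓝 (1, 1, 1)) (𝓝 1) := by
      have : Continuous (fun p : H × H × H => p.1 * (p.2.1⁻¹ * p.2.2 * p.2.1)) := by fun_prop
      simpa using this.tendsto (1, 1, 1)
    have h2 : Tendsto (fun p : H × H × H => p.2.1 * p.2.2 * p.2.1⁻¹ * p.1)
        (𝓝 (1, 1, 1)) (𝓝 1) := by
      have : Continuous (fun p : H × H × H => p.2.1 * p.2.2 * p.2.1⁻¹ * p.1) := by fun_prop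
      simpa using this.tendsto (1, 1, 1)
    have h5 := inter_mem (mem_map.1 (h1 hW)) (mem_map.1 (h2 hW))
    rw [nhds_prod_eq, nhds_prod_eq, mem_prod_iff] at h5
    obtain ⟨A, hA, B, hB, hAB⟩ := h5
    obtain ⟨C, hC, D, hD, hCD⟩ := mem_prod_iff.1 hB
    refine ⟨A ∩ (C ∩ D), inter_mem hA (inter_mem hC hD), fun t ht r hr z hz => ?_⟩
    exact @hAB (t, r, z) ⟨ht.1, hCD ⟨hr.2.1, hz.2.2⟩⟩
  have diam : ∀ {F : Filter H}, Cauchy F → ∀ V ∈ 𝓝 (1 : H), ∃ A ∈ F, ∀ x ∈ A, ∀ y ∈ A,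
      x⁻¹ * y ∈ V ∧ y * x⁻¹ ∈ V := by
    intro F hF V hV
    obtain ⟨A, hA, h⟩ := (cauchy_iff.1 hF).2 {p : H × H | p.1⁻¹ * p.2 ∈ V ∧ p.2 * p.1⁻¹ ∈ V}
      (uniformity_basis_aux.2 ⟨V, hV, fun x y h1 h2 => ⟨h1, h2⟩⟩)
    exact ⟨A, hA, fun x hx y hy => h (mk_mem_prod hx hy)⟩
  obtain ⟨A, hA, hdA⟩ := diam hF V hV
  obtain ⟨B, hB, hdB⟩ := diam hF' V hV
  obtain ⟨a, ha⟩ := hF.1.nonempty_of_mem hA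
  obtain ⟨b, hb⟩ := hF'.1.nonempty_of_mem hB
  have hb1 : Tendsto (fun z : H => b⁻¹ * z * b) (𝓝 1) (𝓝 1) := by
    have : Continuous (fun z : H => b⁻¹ * z * b) := by fun_prop
    simpa using this.tendsto 1
  have ha1 : Tendsto (fun z : H => a * z * a⁻¹) (𝓝 1) (𝓝 1) := by
    have : Continuous (fun z : H => a * z * a⁻¹) := by fun_prop
    simpa using this.tendsto 1
  obtain ⟨A', hA', hdA'⟩ := diam hF _ (hb1 hV)
  obtain ⟨B', hB', hdB'⟩ := diam hF' _ (ha1 hV)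
  have hmem : (fun p : H × H => p.1 * p.2) '' ((A ∩ A') ×ˢ (B ∩ B')) ∈
      map (fun p : H × H => p.1 * p.2) (F ×ˢ F') :=
    image_mem_map (prod_mem_prod (inter_mem hA hA') (inter_mem hB hB'))
  refine mem_of_superset (prod_mem_prod hmem hmem) ?_
  rintro ⟨_, _⟩ ⟨⟨⟨x, y⟩, ⟨hx, hy⟩, rfl⟩, ⟨⟨x', y'⟩, ⟨hx', hy'⟩, rfl⟩⟩
  refine hWs _ _ ?_ ?_
  · have := (hVW (y⁻¹ * y') (hdB y hy.1 y' hy'.1).1 (b⁻¹ * y') (hdB b hb y' hy'.1).1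
      (b⁻¹ * (x⁻¹ * x') * b) (hdA' x hx.2 x' hx'.2).1).1
    convert this using 1
    group
  · have := (hVW (x' * x⁻¹) (hdA x hx.1 x' hx'.1).2 (x' * a⁻¹) (hdA a ha x' hx'.1).2
      (a * (y' * y⁻¹) * a⁻¹) (hdB' y hy.2 y' hy'.2).2).2
    convert this using 1
    group

theorem uniformContinuous_inv_aux : UniformContinuous (fun x : H => x⁻¹) := by
  intro s hs
  obtain ⟨W, hW, hWs⟩ := uniformity_basis_aux.1 hs
  refine uniformity_basis_aux.2 ⟨W⁻¹, inv_mem_nhds_one H hW, fun x y h1 h2 => hWs _ _ ?_ ?_⟩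
  · simpa using h2
  · simpa using h1

noncomputable instance : One (TopRaikov H) := ⟨of 1⟩

/-- Inversion on the completion: the continuous extension of the inversion of `H`. -/
noncomputable instance : Inv (TopRaikov H) :=
  ⟨isDenseInducing_of.extend (fun x : H => of x⁻¹)⟩

/-- Multiplication on the completion: the continuous extension of the multiplication of `H`. -/
noncomputable instance : Mul (TopRaikov H) :=
  ⟨fun x y => (isDenseInducing_of.prodMap isDenseInducing_of).extend
    (fun p : H × H => of (p.1 * p.2)) (x, y)⟩

theorem continuous_mul_aux : Continuous (fun p : TopRaikov H × TopRaikov H => p.1 * p.2) := by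
  refine (isDenseInducing_of.prodMap isDenseInducing_of).continuous_extend
    (f := fun p : H × H => of (p.1 * p.2)) ?_
  rintro ⟨x, y⟩
  have hc : ∀ x : TopRaikov H, Cauchy (comap of (𝓝 x)) := fun x =>
    (isUniformInducing_of.cauchy_map_iff).1
      (cauchy_nhds.mono' (by have := isDenseInducing_of.comap_nhds_neBot x; infer_instance)
        map_comap_le)
  have h := (isUniformInducing_of.cauchy_map_iff).2 (cauchy_mul (hc x) (hc y))
  obtain ⟨c, hc⟩ := CompleteSpace.complete h
  refine ⟨c, ?_⟩
  have hp : comap (Prod.map of of) (𝓝 (x, y)) = comap (of : H → _) (𝓝 x) ×ˢ comap of (𝓝 y) := by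
    rw [nhds_prod_eq, prod_comap_comap_eq]; rfl
  rw [hp]
  rw [map_map] at hc
  exact hc

theorem continuous_inv_aux : Continuous (fun p : TopRaikov H => p⁻¹) :=
  (uniformContinuous_uniformly_extend isUniformInducing_of isDenseInducing_of.dense
    (isUniformInducing_of.uniformContinuous.comp uniformContinuous_inv_aux)).continuous

theorem of_mul (x y : H) : of (x * y) = of x * of y :=
  ((isDenseInducing_of.prodMap isDenseInducing_of).extend_eq
    (f := fun p : H × H => of (p.1 * p.2)) (continuous_of.comp continuous_mul) (x, y)).symm

theorem of_inv (x : H) : of x⁻¹ = (of x)⁻¹ :=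
  (isDenseInducing_of.extend_eq (continuous_of.comp continuous_inv) x).symm

theorem eq_of_eq_on_of {f g : TopRaikov H → TopRaikov H} (hf : Continuous f) (hg : Continuous g)
    (h : ∀ a : H, f (of a) = g (of a)) (x : TopRaikov H) : f x = g x :=
  congrFun (isDenseInducing_of.dense.equalizer hf hg (funext h)) x

noncomputable instance : Group (TopRaikov H) where
  mul_assoc x y z := by
    have hm := @continuous_mul_aux H _ _ _
    have hd : DenseRange (Prod.map of (Prod.map of of) : H × H × H → _) :=
      isDenseInducing_of.dense.prodMap
        (isDenseInducing_of.dense.prodMap (isDenseInducing_of (H := H)).dense)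
    have := hd.equalizer
      (g := fun p : TopRaikov H × TopRaikov H × TopRaikov H => p.1 * p.2.1 * p.2.2)
      (h := fun p => p.1 * (p.2.1 * p.2.2))
      (hm.comp ((hm.comp (continuous_fst.prodMk continuous_snd.fst)).prodMk continuous_snd.snd))
      (hm.comp (continuous_fst.prodMk (hm.comp continuous_snd)))
      (by funext ⟨a, b, c⟩; simp [← of_mul, mul_assoc])
    exact congrFun this (x, y, z)
  one_mul := eq_of_eq_on_of (continuous_mul_aux.comp (continuous_const.prodMk continuous_id))
    continuous_id (fun a => (of_mul 1 a).symm.trans (by simp))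
  mul_one := eq_of_eq_on_of (continuous_mul_aux.comp (continuous_id.prodMk continuous_const))
    continuous_id (fun a => (of_mul a 1).symm.trans (by simp))
  inv_mul_cancel := eq_of_eq_on_of (g := fun _ => 1)
    (continuous_mul_aux.comp (continuous_inv_aux.prodMk continuous_id)) continuous_const
    (fun a => by
      change (of a)⁻¹ * of a = of 1
      rw [← of_inv, ← of_mul, inv_mul_cancel])

instance : IsTopologicalGroup (TopRaikov H) where
  continuous_mul := continuous_mul_aux
  continuous_inv := continuous_inv_aux

end TopRaikov
end TwoSided

/-! ### The Raĭkov completion of a paratopological group -/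

section Para

variable (G : Type u) [Group G] [TopologicalSpace G]

/-- The group coreflection `G^♯` of a paratopological group `G`: the same group with the
topology induced by `x ↦ (x, x⁻¹)`, so that the sets `U ∩ U⁻¹` form a base at the identity. -/
def Coreflection : Type u := G

namespace Coreflection

instance : Group (Coreflection G) := inferInstanceAs (Group G)

variable {G} in
/-- The identity map from `G` to its group coreflection. -/
def of : G ≃* Coreflection G := MulEquiv.refl G

instance : TopologicalSpace (Coreflection G) :=
  TopologicalSpace.induced (fun x => (of.symm x, (of.symm x)⁻¹)) inferInstance

variable {G}

theorem continuous_aux : Continuous (fun x : Coreflection G => (of.symm x, (of.symm x)⁻¹)) :=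
  continuous_induced_dom

theorem mem_nhds_one {s : Set (Coreflection G)} :
    s ∈ 𝓝 (1 : Coreflection G) ↔ ∃ U ∈ 𝓝 (1 : G), of '' (U ∩ U⁻¹) ⊆ s := by
  rw [nhds_induced, map_one, inv_one, nhds_prod_eq, mem_comap]
  constructor
  · rintro ⟨t, ht, hts⟩
    obtain ⟨A, hA, B, hB, hAB⟩ := mem_prod_iff.1 ht
    refine ⟨A ∩ B, inter_mem hA hB, ?_⟩
    rintro _ ⟨x, hx, rfl⟩
    exact hts (hAB ⟨by simpa using hx.1.1, by simpa using hx.2.2⟩)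
  · rintro ⟨U, hU, hs⟩
    exact ⟨U ×ˢ U, prod_mem_prod hU hU, fun x hx => hs ⟨of.symm x, ⟨hx.1, hx.2⟩, by simp⟩⟩

instance [ContinuousMul G] : IsTopologicalGroup (Coreflection G) where
  continuous_mul := by
    have h1 := continuous_aux.comp (continuous_fst (X := Coreflection G) (Y := Coreflection G))
    have h2 := continuous_aux.comp (continuous_snd (X := Coreflection G) (Y := Coreflection G))
    refine continuous_induced_rng.2 (((h1.fst.mul h2.fst).prodMk (h2.snd.mul h1.snd)).congr ?_)
    intro p
    simp
  continuous_inv := by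
    have h := continuous_aux (G := G)
    refine continuous_induced_rng.2 ((h.snd.prodMk h.fst).congr ?_)
    intro p
    simp

end Coreflection

variable [ParatopologicalGroup G]

/-- The Raĭkov completion `Ğ` of a paratopological group `G`. As a group it is the Raĭkov
completion of the topological group `G^♯`; its topology is defined below. -/
def RaikovCompletion : Type u := TopRaikov (Coreflection G)

namespace RaikovCompletion

noncomputable instance : Group (RaikovCompletion G) :=
  inferInstanceAs (Group (TopRaikov (Coreflection G)))

variable {G}

/-- The identity map from `Ğ` to the Raĭkov completion of `G^♯`. -/
noncomputable def toSharp : RaikovCompletion G ≃* TopRaikov (Coreflection G) := MulEquiv.refl _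

/-- The canonical homomorphism from `G` to `Ğ`. -/
noncomputable def of : G →* RaikovCompletion G :=
  MonoidHom.mk' (fun x => toSharp.symm (TopRaikov.of (Coreflection.of x))) fun x y => by
    rw [map_mul, TopRaikov.of_mul, map_mul]

/-- The closure of (the image of) `U ⊆ G` in the Raĭkov completion of `G^♯`. -/
def sharpClosure (U : Set G) : Set (RaikovCompletion G) :=
  toSharp ⁻¹' closure (toSharp '' (of '' U))

variable (G) in
/-- The filter generated by the sets `sharpClosure U`, where `U` is a neighborhood of the identity
in `G`. -/
def nhdsOne : Filter (RaikovCompletion G) := (𝓝 (1 : G)).lift' sharpClosure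

/-- The topology of `Ğ`: a neighborhood base at `x` consists of the sets `x * sharpClosure U`,
where `U` is a neighborhood of the identity in `G` (see `nhds_eq` below). -/
noncomputable instance : TopologicalSpace (RaikovCompletion G) :=
  TopologicalSpace.mkOfNhds fun x => map (fun y => x * y) (nhdsOne G)

theorem mem_sharpClosure {U : Set G} {a : RaikovCompletion G} :
    a ∈ sharpClosure U ↔ toSharp a ∈ closure (toSharp '' (of '' U)) := Iff.rfl

theorem sharpClosure_mono {U V : Set G} (h : U ⊆ V) :
    (sharpClosure U : Set (RaikovCompletion G)) ⊆ sharpClosure V :=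
  preimage_mono (closure_mono (image_mono (image_mono h)))

theorem mem_nhdsOne {s : Set (RaikovCompletion G)} :
    s ∈ nhdsOne G ↔ ∃ U ∈ 𝓝 (1 : G), sharpClosure U ⊆ s :=
  mem_lift'_sets fun _ _ h => sharpClosure_mono h

theorem of_mem_sharpClosure {U : Set G} {x : G} (h : x ∈ U) :
    (of x : RaikovCompletion G) ∈ sharpClosure U :=
  mem_sharpClosure.2 (subset_closure (mem_image_of_mem _ (mem_image_of_mem _ h)))

theorem mul_mem_sharpClosure {U V W : Set G} (h : ∀ x ∈ U, ∀ y ∈ V, x * y ∈ W)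
    {a b : RaikovCompletion G} (ha : a ∈ sharpClosure U) (hb : b ∈ sharpClosure V) :
    a * b ∈ sharpClosure W := by
  rw [mem_sharpClosure] at ha hb ⊢
  rw [map_mul]
  refine map_mem_closure₂ continuous_mul ha hb ?_
  rintro _ ⟨_, ⟨x, hx, rfl⟩, rfl⟩ _ ⟨_, ⟨y, hy, rfl⟩, rfl⟩
  exact ⟨_, ⟨x * y, h x hx y hy, rfl⟩, by rw [map_mul, map_mul]⟩

theorem exists_mul_mem {U : Set G} (hU : U ∈ 𝓝 (1 : G)) :
    ∃ V ∈ 𝓝 (1 : G), ∀ x ∈ V, ∀ y ∈ V, x * y ∈ U := by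
  obtain ⟨V, hV, h1, h⟩ := exists_open_nhds_one_mul_subset hU
  exact ⟨V, hV.mem_nhds h1, fun x hx y hy => h (mul_mem_mul hx hy)⟩

theorem one_mem_sharpClosure {U : Set G} (hU : U ∈ 𝓝 (1 : G)) :
    (1 : RaikovCompletion G) ∈ sharpClosure U := by
  simpa using of_mem_sharpClosure (mem_of_mem_nhds hU)

theorem tendsto_mul_nhdsOne :
    Tendsto (Function.uncurry ((· * ·) : RaikovCompletion G → _ → _))
      (nhdsOne G ×ˢ nhdsOne G) (nhdsOne G) := by
  intro s hs
  obtain ⟨U, hU, hUs⟩ := mem_nhdsOne.1 hs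
  obtain ⟨V, hV, hVU⟩ := exists_mul_mem hU
  have := mem_nhdsOne.2 ⟨V, hV, subset_rfl⟩
  refine mem_map.2 (mem_of_superset (prod_mem_prod this this) ?_)
  rintro ⟨a, b⟩ ⟨ha, hb⟩
  exact hUs (mul_mem_sharpClosure hVU ha hb)

theorem nhds_eq (x : RaikovCompletion G) : 𝓝 x = map (fun y => x * y) (nhdsOne G) := by
  refine TopologicalSpace.nhds_mkOfNhds _ x ?_ ?_
  · intro a s hs
    obtain ⟨U, hU, hUs⟩ := mem_nhdsOne.1 (mem_map.1 hs)
    simpa using hUs (one_mem_sharpClosure hU)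
  · intro a s hs
    obtain ⟨U, hU, hUs⟩ := mem_nhdsOne.1 (mem_map.1 hs)
    obtain ⟨V, hV, hVU⟩ := exists_mul_mem hU
    refine mem_map.2 (mem_nhdsOne.2 ⟨V, hV, fun y hy => ?_⟩)
    refine mem_map.2 (mem_nhdsOne.2 ⟨V, hV, fun z hz => ?_⟩)
    have := hUs (mul_mem_sharpClosure hVU hy hz)
    simpa [mul_assoc] using this

theorem nhds_one : 𝓝 (1 : RaikovCompletion G) = nhdsOne G := by
  simp [nhds_eq]

theorem exists_of_mul (x : RaikovCompletion G) {V : Set G} (hV : V ∈ 𝓝 (1 : G)) :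
    ∃ (g : G) (t : RaikovCompletion G), x = t * of g ∧ t ∈ sharpClosure V ∧
      t⁻¹ ∈ sharpClosure V := by
  have hN : Coreflection.of '' (V ∩ V⁻¹) ∈ 𝓝 (1 : Coreflection G) :=
    Coreflection.mem_nhds_one.2 ⟨V, hV, subset_rfl⟩
  have hN' := TopRaikov.isDenseInducing_of.closure_image_mem_nhds hN
  have hc : Tendsto (fun y => toSharp x * y⁻¹) (𝓝 (toSharp x)) (𝓝 (TopRaikov.of 1)) := by
    have : Continuous (fun y => toSharp x * y⁻¹) := by fun_prop
    have h := this.tendsto (toSharp x)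
    rwa [mul_inv_cancel] at h
  obtain ⟨_, hy, g, rfl⟩ := mem_closure_iff_nhds.1
    (TopRaikov.isDenseInducing_of.dense (toSharp x)) _ (hc hN')
  refine ⟨Coreflection.of.symm g, x * (of (Coreflection.of.symm g))⁻¹, by group, ?_, ?_⟩
  · rw [mem_sharpClosure]
    refine closure_mono ?_ hy
    rintro _ ⟨_, ⟨v, hv, rfl⟩, rfl⟩
    exact ⟨_, ⟨v, hv.1, rfl⟩, rfl⟩
  · rw [mem_sharpClosure, map_inv]
    refine map_mem_closure continuous_inv hy ?_
    rintro _ ⟨_, ⟨v, hv, rfl⟩, rfl⟩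
    refine ⟨_, ⟨v⁻¹, hv.2, rfl⟩, ?_⟩
    rw [← TopRaikov.of_inv, ← map_inv]
    rfl

theorem conj_nhdsOne (x : RaikovCompletion G) :
    Tendsto (fun y => x * y * x⁻¹) (nhdsOne G) (nhdsOne G) := by
  intro s hs
  obtain ⟨U, hU, hUs⟩ := mem_nhdsOne.1 hs
  obtain ⟨V, hV, hVU⟩ := exists_mul_mem hU
  obtain ⟨W, hW, hWV⟩ := exists_mul_mem hV
  have hVWU : ∀ a ∈ V, ∀ b ∈ W, a * b ∈ U := fun a ha b hb =>
    hVU a ha b (by simpa using hWV b hb 1 (mem_of_mem_nhds hW))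
  obtain ⟨g, t, rfl, ht, ht'⟩ := exists_of_mul x hW
  have hg : {y : G | g * y * g⁻¹ ∈ W} ∈ 𝓝 (1 : G) := by
    have : Continuous (fun y : G => g * y * g⁻¹) := by fun_prop
    exact this.continuousAt.preimage_mem_nhds (by simpa using hW)
  refine mem_map.2 (mem_nhdsOne.2 ⟨_, hg, fun y hy => hUs ?_⟩)
  have h1 : of g * y * of g⁻¹ ∈ sharpClosure W :=
    mul_mem_sharpClosure (U := (fun y => g * y) '' {y : G | g * y * g⁻¹ ∈ W}) (V := {g⁻¹})
      (by rintro _ ⟨y, hy, rfl⟩ _ rfl; exact hy)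
      (mul_mem_sharpClosure (U := {g}) (by rintro _ rfl y hy; exact ⟨y, hy, rfl⟩)
        (of_mem_sharpClosure rfl) hy) (of_mem_sharpClosure rfl)
  have h2 := mul_mem_sharpClosure hVWU (mul_mem_sharpClosure hWV ht h1) ht'
  simpa [mul_assoc] using h2

theorem eq_one_of_forall_mem {z : RaikovCompletion G}
    (h : ∀ U ∈ 𝓝 (1 : G), z ∈ sharpClosure U) (h' : ∀ U ∈ 𝓝 (1 : G), z⁻¹ ∈ sharpClosure U) :
    z = 1 := by
  have key : ∀ N ∈ 𝓝 (1 : Coreflection G), toSharp z ∈ closure (TopRaikov.of '' N) := by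
    intro N hN
    obtain ⟨U, hU, hUN⟩ := Coreflection.mem_nhds_one.1 hN
    obtain ⟨V, hV, hVU⟩ := exists_mul_mem hU
    obtain ⟨O, hO, hOV⟩ := (TopRaikov.isDenseInducing_of.nhds_eq_comap (1 : Coreflection G) ▸
      Coreflection.mem_nhds_one.2 ⟨V, hV, subset_rfl⟩ :
        Coreflection.of '' (V ∩ V⁻¹) ∈ comap TopRaikov.of (𝓝 (TopRaikov.of 1)))
    rw [mem_closure_iff_nhds]
    intro M hM
    have hc : Tendsto (fun p : TopRaikov (Coreflection G) × TopRaikov (Coreflection G) =>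
        p.1 * p.2) (𝓝 (toSharp z) ×ˢ 𝓝 (toSharp z⁻¹)) (𝓝 (TopRaikov.of 1)) := by
      have := (continuous_mul (M := TopRaikov (Coreflection G))).tendsto (toSharp z, toSharp z⁻¹)
      rw [nhds_prod_eq, ← map_mul, mul_inv_cancel, map_one] at this
      exact this
    obtain ⟨A, hA, B, hB, hAB⟩ := mem_prod_iff.1 (hc hO)
    obtain ⟨_, ha, _, ⟨g, hg, rfl⟩, rfl⟩ := mem_closure_iff_nhds.1
      (mem_sharpClosure.1 (h V hV)) _ (inter_mem hA hM)
    obtain ⟨_, hb, _, ⟨g', hg', rfl⟩, rfl⟩ := mem_closure_iff_nhds.1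
      (mem_sharpClosure.1 (h' V hV)) _ hB
    have hgg : Coreflection.of (g * g') ∈ TopRaikov.of ⁻¹' O := by
      have := hAB (mk_mem_prod ha.1 hb)
      rw [mem_preimage, map_mul, TopRaikov.of_mul]
      exact this
    obtain ⟨w, hw, hwg⟩ := hOV hgg
    obtain rfl := Coreflection.of.injective hwg
    refine ⟨_, ha.2, _, hUN ⟨g, ⟨?_, ?_⟩, rfl⟩, rfl⟩
    · simpa using hVU g hg 1 (mem_of_mem_nhds hV)
    · have := hVU g' hg' _ hw.2
      simpa using this
  by_contra hz
  have hz' : toSharp z ≠ TopRaikov.of 1 := fun e => hz (toSharp.injective (e.trans (map_one _).symm))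
  have hn : ({toSharp z}ᶜ : Set (TopRaikov (Coreflection G))) ∈ 𝓝 (TopRaikov.of 1) :=
    isOpen_compl_singleton.mem_nhds hz'.symm
  obtain ⟨C, ⟨hC, hCc⟩, hCz⟩ := (closed_nhds_basis _).mem_iff.1 hn
  have := key _ (TopRaikov.continuous_of.continuousAt.preimage_mem_nhds hC)
  exact hCz (hCc.closure_subset_iff.2 (image_preimage_subset _ _) this) rfl

instance : ParatopologicalGroup (RaikovCompletion G) where
  toContinuousMul := by
    refine ContinuousMul.of_nhds_one ?_ ?_ ?_
    · simpa only [nhds_one] using tendsto_mul_nhdsOne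
    · intro x
      rw [nhds_one, nhds_eq]
    · intro x
      rw [nhds_one, nhds_eq]
      refine le_antisymm ?_ ?_
      · have := (tendsto_map (f := fun y => y * x)).comp (conj_nhdsOne x)
        simpa [Function.comp_def, Tendsto] using this
      · have := (tendsto_map (f := fun y => x * y)).comp (conj_nhdsOne x⁻¹)
        simpa [Function.comp_def, Tendsto, mul_assoc] using this
  toT0Space := by
    refine ⟨fun x y hxy => ?_⟩
    have aux : ∀ {x y : RaikovCompletion G}, 𝓝 x = 𝓝 y → ∀ U ∈ 𝓝 (1 : G),
        x⁻¹ * y ∈ sharpClosure U := by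
      intro x y hxy U hU
      have h1 : (fun z => x * z) '' sharpClosure U ∈ 𝓝 y := by
        rw [← hxy, nhds_eq]
        exact image_mem_map (mem_nhdsOne.2 ⟨U, hU, subset_rfl⟩)
      rw [nhds_eq] at h1
      obtain ⟨W, hW, hWs⟩ := mem_nhdsOne.1 (mem_map.1 h1)
      obtain ⟨z, hz, hzy⟩ := hWs (one_mem_sharpClosure hW)
      have : z = x⁻¹ * y := by simpa using congrArg (x⁻¹ * ·) hzy
      exact this ▸ hz
    have h := eq_one_of_forall_mem (aux hxy) (by simpa using aux hxy.symm)
    exact (inv_mul_eq_one.1 h)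

/-- `G` is a topological subgroup of `Ğ`. -/
theorem isEmbedding_of : IsEmbedding (of : G → RaikovCompletion G) := by
  have hind : IsInducing (of : G → RaikovCompletion G) := by
    refine isInducing_iff_nhds.2 fun x => le_antisymm ?_ ?_
    · refine map_le_iff_le_comap.1 fun s hs => ?_
      rw [nhds_eq, mem_map, mem_nhdsOne] at hs
      obtain ⟨U, hU, hUs⟩ := hs
      have : Tendsto (fun y => x⁻¹ * y) (𝓝 x) (𝓝 1) := by
        have h : Continuous (fun y => x⁻¹ * y) := by fun_prop
        simpa using h.tendsto x
      refine mem_map.2 (mem_of_superset (this hU) fun y hy => ?_)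
      simpa [← map_mul] using hUs (of_mem_sharpClosure hy)
    · intro s hs
      have hx : {y | x * y ∈ s} ∈ 𝓝 (1 : G) := by
        have h : Continuous (fun y => x * y) := by fun_prop
        exact h.continuousAt.preimage_mem_nhds (by simpa using hs)
      obtain ⟨V, hV, hVs⟩ := exists_mul_mem hx
      refine mem_comap.2 ⟨(fun z => of x * z) '' sharpClosure V, ?_, ?_⟩
      · rw [nhds_eq]
        exact image_mem_map (mem_nhdsOne.2 ⟨V, hV, subset_rfl⟩)
      · rintro y ⟨z, hz, hzy⟩
        have hz' : z = of (x⁻¹ * y) := by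
          rw [map_mul, map_inv]
          exact eq_inv_mul_of_mul_eq hzy
        rw [hz', mem_sharpClosure] at hz
        have hcl : Coreflection.of (x⁻¹ * y) ∈ closure (Coreflection.of '' V) := by
          rw [TopRaikov.isDenseInducing_of.isInducing.closure_eq_preimage_closure_image,
            mem_preimage]
          refine closure_mono ?_ hz
          rintro _ ⟨_, ⟨v, hv, rfl⟩, rfl⟩
          exact ⟨_, ⟨v, hv, rfl⟩, rfl⟩
        have hN : Coreflection.of '' (V ∩ V⁻¹) ∈ 𝓝 (1 : Coreflection G) :=
          Coreflection.mem_nhds_one.2 ⟨V, hV, subset_rfl⟩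
        have hc : Tendsto (fun c => c⁻¹ * Coreflection.of (x⁻¹ * y))
            (𝓝 (Coreflection.of (x⁻¹ * y))) (𝓝 1) := by
          have h : Continuous (fun c => c⁻¹ * Coreflection.of (x⁻¹ * y)) := by fun_prop
          simpa using h.tendsto (Coreflection.of (x⁻¹ * y))
        obtain ⟨_, ⟨w, hw, hwe⟩, v, hv, rfl⟩ := mem_closure_iff_nhds.1 hcl _ (hc hN)
        have hw' : w = v⁻¹ * (x⁻¹ * y) := Coreflection.of.injective (by simpa using hwe)
        have := hVs v hv w hw.1
        simpa [hw'] using this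
  exact hind.isEmbedding

end RaikovCompletion

end Para

/-! ### `𝒞`-completions -/

/-- A class of continuous homomorphisms between paratopological groups. -/
abbrev ParaHomClass : Type (max (u + 1) (v + 1)) :=
  ∀ (X : Type v) (Y : Type u) [Group X] [TopologicalSpace X] [ParatopologicalGroup X]
    [Group Y] [TopologicalSpace Y] [ParatopologicalGroup Y], Set (X →ₜ* Y)

/-- `Y` is `𝒞`-complete: every homomorphism `h : X → Y` in `𝒞` extends to a continuous
homomorphism from the Raĭkov completion of `X` to `Y`. -/
def IsCComplete (C : ParaHomClass.{u, v}) (Y : Type u) [Group Y] [TopologicalSpace Y]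
    [ParatopologicalGroup Y] : Prop :=
  ∀ (X : Type v) [Group X] [TopologicalSpace X] [ParatopologicalGroup X] (h : X →ₜ* Y),
    h ∈ C X Y → ∃ h' : RaikovCompletion X →ₜ* Y, ∀ x : X, h' (RaikovCompletion.of x) = h x

/-- The `𝒞`-completion of `G`: the intersection of all `𝒞`-complete subgroups of `Ğ` that
contain `G`. -/
noncomputable def cCompletion (C : ParaHomClass.{u, v}) (G : Type u) [Group G] [TopologicalSpace G]
    [ParatopologicalGroup G] : Subgroup (RaikovCompletion G) :=
  sInf {H : Subgroup (RaikovCompletion G) | RaikovCompletion.of.range ≤ H ∧ IsCComplete C H}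

/-! ### Properties of spaces and of paratopological groups -/

/-- Every continuous real-valued function is bounded. -/
def IsPseudocompact (X : Type v) [TopologicalSpace X] : Prop :=
  ∀ f : X → ℝ, Continuous f → Bornology.IsBounded (range f)

/-- For every neighborhood `U` of the identity there is a continuous homomorphism to a Hausdorff
paratopological group of countable pseudocharacter (every point is a `G_δ`) whose kernel is
contained in `U`. -/
def IsProjectivelyPsi (G : Type u) [Group G] [TopologicalSpace G] : Prop :=
  ∀ U ∈ 𝓝 (1 : G), ∃ (Y : Type u) (_ : Group Y) (_ : TopologicalSpace Y)
    (_ : ParatopologicalGroup Y) (h : G →ₜ* Y),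
    T2Space Y ∧ (∀ y : Y, IsGδ {y}) ∧ h ⁻¹' {1} ⊆ U

/-- For every neighborhood `U` of the identity there is a countable family `𝒱` of neighborhoods of
the identity such that every `x` admits `V ∈ 𝒱` with `x V x⁻¹ ⊆ U`. -/
def IsOmegaBalanced (G : Type u) [Group G] [TopologicalSpace G] : Prop :=
  ∀ U ∈ 𝓝 (1 : G), ∃ 𝒱 : Set (Set G), 𝒱.Countable ∧ (∀ V ∈ 𝒱, V ∈ 𝓝 (1 : G)) ∧
    ∀ x : G, ∃ V ∈ 𝒱, (fun v => x * v * x⁻¹) '' V ⊆ U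

/-- The Hausdorff number of a Hausdorff paratopological group: the smallest cardinal `κ ≥ 1` such
that every neighborhood `U` of the identity contains `⋂ α ∈ κ, V α * (V α)⁻¹` for some family of
`κ` neighborhoods of the identity. (Meaningful for Hausdorff `G`, where such `κ` exists.) -/
noncomputable def hausdorffNumber (G : Type u) [Group G] [TopologicalSpace G] : Cardinal.{u} :=
  sInf {κ : Cardinal.{u} | 1 ≤ κ ∧ ∀ U ∈ 𝓝 (1 : G), ∃ V : κ.out → Set G,
    (∀ α, V α ∈ 𝓝 (1 : G)) ∧ (⋂ α, V α * (V α)⁻¹) ⊆ U}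

/-
Let `h : G → Y` be a continuous homomorphism into a group in which `{1}` is a `Gδ`. The preimage of
`Y` under the extension `Ğ → Y̆` of `h` is a `𝒞`-complete subgroup: the image in `ϱ(Y^♯)` of a
pseudocompact topological group `X` is pseudocompact with `{1}` a `Gδ`, hence metrizable and
complete, hence closed, so the extension of a homomorphism `X → Y` to `X̆` takes values in `Y`.
Consequently `h` extends to `𝒞[G]`, and the topology of `𝒞[G]` at the identity is generated by
these extensions whenever that of `G` is generated by such homomorphisms `h`. Projectively `Ψ`
groups are of this kind, and a Hausdorff group is `ω`-balanced with `Hs(G) ≤ ω` exactly when it is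
of this kind with Hausdorff first countable `Y`.
-/

namespace IsPseudocompact

section Space

variable {X : Type u} [TopologicalSpace X]

theorem not_locallyFinite [CompletelyRegularSpace X] (hX : IsPseudocompact X) {E : ℕ → Set X}
    (hE : ∀ n, IsOpen (E n)) (hne : ∀ n, (E n).Nonempty) : ¬ LocallyFinite E := by
  intro hfin
  choose p hp using hne
  have bump (n : ℕ) : ∃ f : X → ℝ, Continuous f ∧ 0 ≤ f ∧ f (p n) = n ∧
      Function.support f ⊆ E n := by
    obtain ⟨f, hf, hfp, hfE⟩ := CompletelyRegularSpace.completely_regular (p n) (E n)ᶜ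
      (hE n).isClosed_compl (not_not.2 (hp n))
    refine ⟨fun x => n * (1 - f x), by fun_prop, fun x => ?_, by simp [hfp], fun x hx => ?_⟩
    · exact mul_nonneg n.cast_nonneg (sub_nonneg.2 (f x).2.2)
    · by_contra hxE
      exact hx (by simp [hfE hxE])
  choose f hf hf0 hfp hfE using bump
  have hsupp : LocallyFinite fun n => Function.support (f n) := hfin.subset hfE
  obtain ⟨c, hc⟩ := (hX _ (continuous_finsum hf hsupp)).bddAbove
  obtain ⟨n, hn⟩ := exists_nat_gt c
  have : (n : ℝ) ≤ c := calc
    (n : ℝ) = f n (p n) := (hfp n).symm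
    _ ≤ ∑ᶠ i, f i (p n) :=
      single_le_finsum n (hsupp.point_finite (p n)) fun i => hf0 i (p n)
    _ ≤ c := hc (mem_range_self (p n))
  exact this.not_gt hn

theorem exists_frequently_inter_nonempty [CompletelyRegularSpace X] (hX : IsPseudocompact X)
    {E : ℕ → Set X} (hE : ∀ n, IsOpen (E n)) (hne : ∀ n, (E n).Nonempty) :
    ∃ c, ∀ U ∈ 𝓝 c, ∃ᶠ n in atTop, (E n ∩ U).Nonempty := by
  have h := hX.not_locallyFinite hE hne
  simpa only [LocallyFinite, Nat.frequently_atTop_iff_infinite, not_forall, not_exists, not_and,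
    ← not_infinite, not_not] using h

theorem of_surjective {Y : Type v} [TopologicalSpace Y] (hX : IsPseudocompact X) {f : X → Y}
    (hf : Continuous f) (hsurj : Function.Surjective f) : IsPseudocompact Y := fun g hg => by
  simpa only [hsurj.range_comp] using hX (g ∘ f) (hg.comp hf)

theorem isCountablyGenerated_nhds [CompletelyRegularSpace X] (hX : IsPseudocompact X) {p : X}
    (hp : IsGδ {p}) : (𝓝 p).IsCountablyGenerated := by
  obtain ⟨O, hO, hOp⟩ := isGδ_iff_eq_iInter_nat.1 hp
  have hpO (n : ℕ) : O n ∈ 𝓝 p :=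
    (hO n).mem_nhds (mem_iInter.1 (hOp ▸ mem_singleton p) n)
  choose C hC hCc hCO using fun n => exists_mem_nhds_isClosed_subset (hpO n)
  let N : ℕ → Set X := dissipate fun n => interior (C n)
  have hNo (n : ℕ) : IsOpen (N n) := by
    simp only [N, dissipate_def]
    exact (finite_le_nat n).isOpen_biInter fun k _ => isOpen_interior
  have hNp (n : ℕ) : N n ∈ 𝓝 p := (hNo n).mem_nhds <|
    mem_dissipate.2 fun k _ => mem_interior_iff_mem_nhds.2 (hC k)
  have hbasis : (𝓝 p).HasBasis (fun _ => True) N := by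
    refine ⟨fun s => ⟨fun hs => ?_, fun ⟨n, _, hn⟩ => mem_of_superset (hNp n) hn⟩⟩
    obtain ⟨F, hF, hFc, hFs⟩ := exists_mem_nhds_isClosed_subset hs
    by_contra! hcon
    obtain ⟨c, hc⟩ := hX.exists_frequently_inter_nonempty (E := fun n => N n \ F)
      (fun n => (hNo n).sdiff hFc)
      fun n => sdiff_nonempty.2 fun h => hcon n trivial (h.trans hFs)
    have hcC (k : ℕ) : c ∈ C k := by
      rw [← (hCc k).closure_eq, mem_closure_iff_nhds]
      intro U hU
      obtain ⟨n, ⟨x, ⟨hxN, -⟩, hxU⟩, hkn⟩ :=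
        ((hc U hU).and_eventually (eventually_ge_atTop k)).exists
      exact ⟨x, hxU, interior_subset (mem_dissipate.1 hxN k hkn)⟩
    obtain rfl : c = p := hOp.ge (mem_iInter.2 fun k => hCO k (hcC k))
    obtain ⟨n, x, ⟨-, hxF⟩, hx⟩ := (hc F hF).exists
    exact hxF hx
  exact hbasis.isCountablyGenerated

end Space

theorem completeSpace {X : Type u} [UniformSpace X] [(𝓤 X).IsCountablyGenerated]
    (hX : IsPseudocompact X) : CompleteSpace X := by
  refine UniformSpace.complete_of_cauchySeq_tendsto fun x hx => ?_
  obtain ⟨V, hV⟩ := (𝓤 X).exists_antitone_basis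
  obtain ⟨c, hc⟩ := hX.exists_frequently_inter_nonempty
    (E := fun n => interior (UniformSpace.ball (x n) (V n))) (fun n => isOpen_interior)
    fun n => ⟨x n, mem_interior_iff_mem_nhds.2 (UniformSpace.ball_mem_nhds _ (hV.mem n))⟩
  refine ⟨c, le_nhds_of_cauchy_adhp hx ?_⟩
  refine mapClusterPt_iff_frequently.2 fun U hU => ?_
  obtain ⟨W, hW, hWU⟩ := UniformSpace.mem_nhds_iff.1 hU
  obtain ⟨T, hT, hTsymm, hTW⟩ := comp_symm_mem_uniformity_sets hW
  refine ((hc _ (UniformSpace.ball_mem_nhds c hT)).and_eventually (hV.eventually_subset hT)).mono ?_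
  rintro n ⟨⟨y, hyx, hyc⟩, hVT⟩
  exact hWU (hTW ⟨y, hyc, hTsymm.symm _ _ (hVT (interior_subset (s := UniformSpace.ball _ _) hyx))⟩)

theorem isClosed_subgroup {B : Type u} [Group B] [TopologicalSpace B] [IsTopologicalGroup B]
    [T0Space B] {S : Subgroup B} (hS : IsPseudocompact S) (h1 : IsGδ ({1} : Set S)) :
    IsClosed (S : Set B) := by
  let _ : UniformSpace B := IsTopologicalGroup.leftUniformSpace B
  have : (𝓝 (1 : S)).IsCountablyGenerated := hS.isCountablyGenerated_nhds h1
  have huniformity : 𝓤 S = comap (fun p : S × S => p.1⁻¹ * p.2) (𝓝 1) := by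
    rw [nhds_induced, comap_comap]
    exact comap_comap
  have : (𝓤 S).IsCountablyGenerated := huniformity ▸ comap.isCountablyGenerated _ _
  have := hS.completeSpace
  exact (completeSpace_coe_iff_isComplete.1 this).isClosed

theorem isClosed_range {X : Type u} {B : Type v} [Group X] [TopologicalSpace X] [Group B]
    [TopologicalSpace B] [IsTopologicalGroup B] [T0Space B] (hX : IsPseudocompact X)
    {f : X →* B} (hf : Continuous f) (h1 : IsGδ ({1} : Set f.range)) :
    IsClosed (range f) :=
  isClosed_subgroup (hX.of_surjective (hf.subtype_mk _) f.rangeRestrict_surjective) h1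

end IsPseudocompact

namespace TopRaikov

variable {A : Type u} {B : Type v} [Group A] [TopologicalSpace A] [IsTopologicalGroup A]
  [Group B] [TopologicalSpace B] [IsTopologicalGroup B]

theorem exists_nhds_one_of_mem_uniformity {D : Set (TopRaikov B × TopRaikov B)}
    (hD : D ∈ 𝓤 (TopRaikov B)) :
    ∃ M ∈ 𝓝 (1 : TopRaikov B), ∀ a b, a⁻¹ * b ∈ M → b * a⁻¹ ∈ M → (a, b) ∈ D := by
  obtain ⟨E, ⟨hE, hEc⟩, hED⟩ := uniformity_hasBasis_closed.mem_iff.1 hD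
  let _ := twoSidedUniformSpace B
  have hE' : Prod.map of of ⁻¹' E ∈ 𝓤 B := by
    rw [← (isUniformInducing_of (H := B)).comap_uniformity]
    exact preimage_mem_comap hE
  obtain ⟨W, hW, hWE⟩ := uniformity_basis_aux.1 hE'
  rw [isDenseInducing_of.nhds_eq_comap] at hW
  obtain ⟨M, hM, hMW⟩ := hW
  obtain ⟨O, hOM, hO, h1O⟩ := mem_nhds_iff.1 hM
  refine ⟨O, hO.mem_nhds h1O, fun a b hab hba => hED ?_⟩
  let P := {p : TopRaikov B × TopRaikov B | p.1⁻¹ * p.2 ∈ O ∧ p.2 * p.1⁻¹ ∈ O}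
  have hP : P ∈ 𝓝 (a, b) :=
    ((hO.preimage (by fun_prop)).inter (hO.preimage (by fun_prop))).mem_nhds ⟨hab, hba⟩
  have hPE : P ∩ range (Prod.map of of) ⊆ E := by
    rintro _ ⟨hp, ⟨x, y⟩, rfl⟩
    refine hWE x y (hMW (hOM ?_)) (hMW (hOM ?_))
    · rw [of_mul, of_inv]; exact hp.1
    · rw [of_mul, of_inv]; exact hp.2
  refine closure_minimal hPE hEc (mem_closure_iff_nhds.2 fun T hT => ?_)
  have := mem_closure_iff_nhds.1 (isDenseInducing_of.dense.prodMap isDenseInducing_of.dense (a, b))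
    _ (inter_mem hT hP)
  rwa [inter_assoc] at this

theorem uniformContinuous_of_continuous {φ : A →* TopRaikov B} (hφ : Continuous φ) :
    @UniformContinuous _ _ (twoSidedUniformSpace A) _ φ := fun D hD => by
  obtain ⟨M, hM, hMD⟩ := exists_nhds_one_of_mem_uniformity hD
  have hφM : φ ⁻¹' M ∈ 𝓝 1 := hφ.continuousAt.preimage_mem_nhds (by rwa [map_one])
  refine uniformity_basis_aux.2 ⟨_, hφM, fun x y hxy hyx => hMD _ _ ?_ ?_⟩
  · rwa [← map_inv, ← map_mul]
  · rwa [← map_inv, ← map_mul]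

/-- The continuous extension to `ϱA` of a continuous homomorphism from `A` to `ϱB`. -/
noncomputable def extend (φ : A →ₜ* TopRaikov B) : TopRaikov A →ₜ* TopRaikov B :=
  have hcont : Continuous (isDenseInducing_of.extend φ) :=
    let _ := twoSidedUniformSpace A
    (uniformContinuous_uniformly_extend isUniformInducing_of isDenseInducing_of.dense
      (uniformContinuous_of_continuous (φ := φ.toMonoidHom) (map_continuous φ))).continuous
  have hof (a : A) : isDenseInducing_of.extend φ (of a) = φ a :=
    isDenseInducing_of.extend_eq (map_continuous φ) a
  { toMonoidHom := MonoidHom.mk' (isDenseInducing_of.extend φ) fun x y =>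
      isDenseInducing_of.dense.induction_on₂
        (p := fun x y => isDenseInducing_of.extend φ (x * y) =
          isDenseInducing_of.extend φ x * isDenseInducing_of.extend φ y)
        (isClosed_eq (by fun_prop) (by fun_prop))
        (fun a b => by rw [← of_mul, hof, hof, hof, map_mul]) x y
    continuous_toFun := hcont }

@[simp]
theorem extend_of (φ : A →ₜ* TopRaikov B) (a : A) : extend φ (of a) = φ a :=
  isDenseInducing_of.extend_eq (map_continuous φ) a

theorem exists_mul_inv_of_mem (x : TopRaikov A) {N : Set (TopRaikov A)} (hN : N ∈ 𝓝 1) :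
    ∃ a : A, x * (of a)⁻¹ ∈ N := by
  have hcont : Continuous fun y => x * y⁻¹ := by fun_prop
  exact isDenseInducing_of.dense.mem_nhds <|
    hcont.continuousAt.preimage_mem_nhds (by rwa [mul_inv_cancel])

end TopRaikov

namespace Coreflection

variable {A : Type u} {B : Type v} [Group A] [TopologicalSpace A] [Group B] [TopologicalSpace B]

theorem continuous_of [IsTopologicalGroup A] : Continuous (of : A → Coreflection A) :=
  continuous_induced_rng.2 (continuous_id.prodMk continuous_inv)

/-- The functoriality of the coreflection `G ↦ G^♯`. -/
def map (f : A →ₜ* B) : Coreflection A →ₜ* Coreflection B where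
  toMonoidHom := (of.toMonoidHom.comp f.toMonoidHom).comp of.symm.toMonoidHom
  continuous_toFun := continuous_induced_rng.2 <|
    (((map_continuous f).prodMap (map_continuous f)).comp continuous_aux).congr fun x =>
      Prod.ext rfl (map_inv f (of.symm x))

end Coreflection

theorem map_const_mul_nhds_one {G : Type u} [Group G] [TopologicalSpace G] [ContinuousMul G]
    (x : G) : map (x * ·) (𝓝 1) = 𝓝 x := by
  simpa using (Homeomorph.mulLeft x).map_nhds_eq 1

theorem continuous_of_tendsto_one {A : Type u} {B : Type v} [Group A] [TopologicalSpace A]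
    [ContinuousMul A] [Group B] [TopologicalSpace B] [ContinuousMul B] {f : A →* B}
    (hf : Tendsto f (𝓝 1) (𝓝 1)) : Continuous f :=
  continuous_iff_continuousAt.2 fun x => by
    simpa only [ContinuousAt, ← map_const_mul_nhds_one x, tendsto_map'_iff, Function.comp_def,
      map_mul, mul_one] using hf.const_mul (f x)

namespace RaikovCompletion

section Sharp

variable {G : Type u} [Group G] [TopologicalSpace G] [ParatopologicalGroup G]

theorem sharpClosure_mem_nhds {U : Set G} (hU : U ∈ 𝓝 (1 : G)) :
    sharpClosure U ∈ 𝓝 (1 : RaikovCompletion G) :=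
  nhds_one (G := G) ▸ mem_nhdsOne.2 ⟨U, hU, subset_rfl⟩

theorem continuous_toSharp_symm :
    Continuous (toSharp.symm : TopRaikov (Coreflection G) → RaikovCompletion G) := by
  refine continuous_of_tendsto_nhds_one toSharp.symm fun s hs => ?_
  rw [nhds_one] at hs
  obtain ⟨U, hU, hUs⟩ := mem_nhdsOne.1 hs
  have hclosure : closure (TopRaikov.of '' (Coreflection.of '' (U ∩ U⁻¹))) ∈
      𝓝 (1 : TopRaikov (Coreflection G)) :=
    TopRaikov.isDenseInducing_of.closure_image_mem_nhds
      (Coreflection.mem_nhds_one.2 ⟨U, hU, subset_rfl⟩)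
  refine mem_map.2 (mem_of_superset hclosure fun y hy => hUs ?_)
  refine closure_mono (X := TopRaikov (Coreflection G)) ?_ hy
  rintro _ ⟨_, ⟨v, hv, rfl⟩, rfl⟩
  exact ⟨_, ⟨v, hv.1, rfl⟩, rfl⟩

theorem continuous_toSharp_comp_symm :
    Continuous fun z : Coreflection (RaikovCompletion G) => toSharp (Coreflection.of.symm z) := by
  refine continuous_of_tendsto_nhds_one (Coreflection.of.symm.trans toSharp) fun M hM => ?_
  obtain ⟨N, hN, hNM⟩ := exists_nhds_one_split hM
  obtain ⟨U, hU, hUN⟩ := Coreflection.mem_nhds_one.1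
    (TopRaikov.continuous_of.continuousAt.preimage_mem_nhds hN)
  obtain ⟨O, hO, hOU⟩ := mem_comap.1 (isEmbedding_of.isInducing.nhds_eq_comap (1 : G) ▸ hU)
  rw [map_one] at hO
  obtain ⟨V, hV, hVO⟩ := exists_nhds_one_split hO
  have hVsharp : toSharp.symm ⁻¹' V ∈ 𝓝 (1 : TopRaikov (Coreflection G)) :=
    continuous_toSharp_symm.continuousAt.preimage_mem_nhds (by rwa [map_one])
  refine mem_map.2 (Coreflection.mem_nhds_one.2 ⟨V, hV, ?_⟩)
  rintro _ ⟨z, ⟨hz, hz'⟩, rfl⟩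
  obtain ⟨a, haN, haV, haV'⟩ := TopRaikov.exists_mul_inv_of_mem (toSharp z) (inter_mem hN
    (inter_mem hVsharp (inv_mem_nhds_one _ hVsharp)))
  obtain ⟨g, rfl⟩ := Coreflection.of.surjective a
  -- `z` is the product of a small element of `ϱ(G^♯)` and of `g`, which is small in `G^♯`
  replace haV : z * (of g)⁻¹ ∈ V := haV
  replace haV' : (z * (of g)⁻¹)⁻¹ ∈ V := haV'
  have hg : g ∈ U := hOU (by simpa using hVO _ haV' _ hz)
  have hg' : g⁻¹ ∈ U := hOU (by simpa using hVO _ hz' _ haV)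
  have hgN : TopRaikov.of (Coreflection.of g) ∈ N := hUN ⟨g, ⟨hg, hg'⟩, rfl⟩
  simpa using hNM _ haN _ hgN

/-- The identity map as an isomorphism of topological groups `(Ğ)^♯ ≃ ϱ(G^♯)`. -/
noncomputable def sharpEquiv :
    Coreflection (RaikovCompletion G) ≃ₜ* TopRaikov (Coreflection G) where
  toMulEquiv := Coreflection.of.symm.trans toSharp
  continuous_toFun := continuous_toSharp_comp_symm
  continuous_invFun := continuous_induced_rng.2 <|
    continuous_toSharp_symm.prodMk (continuous_toSharp_symm.comp continuous_inv)

end Sharp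

variable {A : Type u} {B : Type v} [Group A] [TopologicalSpace A] [ParatopologicalGroup A]
  [Group B] [TopologicalSpace B] [ParatopologicalGroup B]

/-- The homomorphism `ϱ(A^♯) → ϱ(B^♯)` induced by a continuous homomorphism `A → B̆`. -/
noncomputable def sharpExtend (φ : A →ₜ* RaikovCompletion B) :
    TopRaikov (Coreflection A) →ₜ* TopRaikov (Coreflection B) :=
  TopRaikov.extend <|
    (ContinuousMonoidHom.toContinuousMonoidHom sharpEquiv).comp (Coreflection.map φ)

theorem sharpExtend_toSharp_of (φ : A →ₜ* RaikovCompletion B) (a : A) :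
    sharpExtend φ (toSharp (of a)) = toSharp (φ a) :=
  TopRaikov.extend_of _ (Coreflection.of a)

/-- The continuous extension to `Ă` of a continuous homomorphism from `A` to `B̆`. -/
noncomputable def extend (φ : A →ₜ* RaikovCompletion B) :
    RaikovCompletion A →ₜ* RaikovCompletion B where
  toMonoidHom := (toSharp.symm.toMonoidHom.comp (sharpExtend φ).toMonoidHom).comp
    toSharp.toMonoidHom
  continuous_toFun := by
    refine continuous_of_tendsto_one fun s hs => ?_
    obtain ⟨U, hU, hUs⟩ := mem_nhdsOne.1 (nhds_one (G := B) ▸ hs)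
    have hV : φ ⁻¹' sharpClosure U ∈ 𝓝 1 :=
      (map_continuous φ).continuousAt.preimage_mem_nhds
        (by simpa using sharpClosure_mem_nhds hU)
    refine mem_map.2 (mem_of_superset (sharpClosure_mem_nhds hV) fun x hx => hUs ?_)
    have hmaps : MapsTo (sharpExtend φ) (toSharp '' (of '' (φ ⁻¹' sharpClosure U)))
        (closure (toSharp '' (of '' U))) := by
      rintro _ ⟨_, ⟨a, ha, rfl⟩, rfl⟩
      rw [sharpExtend_toSharp_of]
      exact ha
    exact closure_minimal hmaps.image_subset isClosed_closure
      (image_closure_subset_closure_image (map_continuous _) (mem_image_of_mem _ hx))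

@[simp]
theorem extend_of (φ : A →ₜ* RaikovCompletion B) (a : A) : extend φ (of a) = φ a :=
  toSharp.injective (sharpExtend_toSharp_of φ a)

theorem hom_ext {φ ψ : RaikovCompletion A →ₜ* RaikovCompletion B}
    (h : ∀ a : A, φ (of a) = ψ (of a)) : φ = ψ := by
  have hsharp (χ : RaikovCompletion A →ₜ* RaikovCompletion B) :
      Continuous fun y => toSharp (χ (toSharp.symm y)) :=
    (map_continuous sharpEquiv).comp
      ((map_continuous (Coreflection.map χ)).comp (map_continuous sharpEquiv.symm))
  ext x
  exact toSharp.injective (congrFun (TopRaikov.isDenseInducing_of.dense.equalizer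
    (hsharp φ) (hsharp ψ) (funext fun a => congrArg toSharp (h (Coreflection.of.symm a))))
    (toSharp x))

/-- The continuous homomorphism `Ă → B̆` extending a continuous homomorphism `A → B`. -/
noncomputable def map (h : A →ₜ* B) : RaikovCompletion A →ₜ* RaikovCompletion B :=
  extend ⟨of.comp h.toMonoidHom, isEmbedding_of.continuous.comp (map_continuous h)⟩

@[simp]
theorem map_of (h : A →ₜ* B) (a : A) : map h (of a) = of (h a) :=
  extend_of _ a

end RaikovCompletion

namespace RaikovCompletion

section

variable {A : Type u} {B : Type v} [Group A] [TopologicalSpace A] [Group B] [TopologicalSpace B]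
  [ParatopologicalGroup B]

theorem exists_of_comp_eq {φ : A →ₜ* RaikovCompletion B} (h : ∀ a, φ a ∈ (of (G := B)).range) :
    ∃ f : A →ₜ* B, ∀ a, of (f a) = φ a := by
  let e := MonoidHom.ofInjective (isEmbedding_of (G := B)).injective
  let f := e.symm.toMonoidHom.comp (φ.toMonoidHom.codRestrict _ h)
  have hf (a : A) : of (f a) = φ a := congrArg Subtype.val (e.apply_symm_apply ⟨φ a, h a⟩)
  refine ⟨⟨f, isEmbedding_of.isInducing.continuous_iff.2 ?_⟩, hf⟩
  exact (map_continuous φ).congr fun a => (hf a).symm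

end

section

variable {X : Type v} {Y : Type u} [Group X] [TopologicalSpace X] [ParatopologicalGroup X]
  [IsTopologicalGroup X] [Group Y] [TopologicalSpace Y] [ParatopologicalGroup Y]

theorem exists_map_eq_of (hX : IsPseudocompact X) (hY : IsGδ ({1} : Set Y)) (f : X →ₜ* Y)
    (x : RaikovCompletion X) : ∃ a, map f x = of (f a) := by
  let φ : X →ₜ* RaikovCompletion Y :=
    ⟨of.comp f.toMonoidHom, isEmbedding_of.continuous.comp (map_continuous f)⟩
  let θ : X →* TopRaikov (Coreflection Y) := toSharp.toMonoidHom.comp φ.toMonoidHom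
  have hθ : Continuous θ := TopRaikov.continuous_of.comp
    ((map_continuous (Coreflection.map f)).comp Coreflection.continuous_of)
  have hrange : IsGδ ({1} : Set θ.range) := by
    let ι : θ.range →ₜ* RaikovCompletion Y :=
      ⟨toSharp.symm.toMonoidHom.comp θ.range.subtype,
        continuous_toSharp_symm.comp continuous_subtype_val⟩
    have hι : Function.Injective ι := toSharp.symm.injective.comp Subtype.val_injective
    obtain ⟨k, hk⟩ := exists_of_comp_eq (φ := ι) <| by
      rintro ⟨_, a, rfl⟩
      exact ⟨f a, rfl⟩
    have hk' : Function.Injective k := .of_comp (f := of) ((funext hk : of ∘ k = ι) ▸ hι)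
    have : k ⁻¹' {1} = {1} := ext fun z => map_eq_one_iff k hk'
    exact this ▸ hY.preimage (map_continuous k)
  have hclosed : IsClosed (range θ) := hX.isClosed_range hθ hrange
  have hmem (y : TopRaikov (Coreflection X)) : sharpExtend φ y ∈ range θ :=
    TopRaikov.isDenseInducing_of.dense.induction_on (p := fun y => sharpExtend φ y ∈ range θ) y
      (hclosed.preimage (map_continuous _)) fun a =>
        ⟨Coreflection.of.symm a, (sharpExtend_toSharp_of φ (Coreflection.of.symm a)).symm⟩
  obtain ⟨a, ha⟩ := hmem (toSharp x)
  exact ⟨a, toSharp.injective ha.symm⟩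

end

variable {G Y : Type u} [Group G] [TopologicalSpace G] [ParatopologicalGroup G]
  [Group Y] [TopologicalSpace Y] [ParatopologicalGroup Y]

/-- The preimage of `Y` under the homomorphism `Ğ → Y̆` extending `h : G → Y`. It contains `𝒞[G]`
when the domains of `𝒞` are pseudocompact groups and `{1}` is a `Gδ` in `Y`. -/
noncomputable def extensionDomain (h : G →ₜ* Y) : Subgroup (RaikovCompletion G) :=
  (of (G := Y)).range.comap (map h).toMonoidHom

theorem range_of_le_extensionDomain (h : G →ₜ* Y) : of.range ≤ extensionDomain h := by
  rintro _ ⟨g, rfl⟩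
  exact ⟨h g, (map_of h g).symm⟩

theorem exists_extension_extensionDomain {X : Type v} [Group X] [TopologicalSpace X]
    [ParatopologicalGroup X] [IsTopologicalGroup X] (hX : IsPseudocompact X)
    (hY : IsGδ ({1} : Set Y)) (h : G →ₜ* Y) (f : X →ₜ* extensionDomain h) :
    ∃ f' : RaikovCompletion X →ₜ* extensionDomain h, ∀ x, f' (of x) = f x := by
  let F : RaikovCompletion X →ₜ* RaikovCompletion G :=
    extend ⟨(extensionDomain h).subtype.comp f.toMonoidHom,
      continuous_subtype_val.comp (map_continuous f)⟩
  have hF (x : X) : F (of x) = f x := extend_of _ x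
  obtain ⟨g, hg⟩ := exists_of_comp_eq (φ := (map h).comp
    ((⟨(extensionDomain h).subtype, continuous_subtype_val⟩ :
      extensionDomain h →ₜ* RaikovCompletion G).comp f)) fun x => (f x).2
  have hFg : (map h).comp F = map g := hom_ext fun x => by
    rw [map_of, hg]
    exact congrArg (map h) (hF x)
  have hmem (x : RaikovCompletion X) : F x ∈ extensionDomain h := by
    obtain ⟨a, ha⟩ := exists_map_eq_of hX hY g x
    exact ⟨g a, by rw [← ha, ← hFg]; rfl⟩
  exact ⟨⟨F.toMonoidHom.codRestrict _ hmem, (map_continuous F).subtype_mk hmem⟩,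
    fun x => Subtype.ext (hF x)⟩

theorem mem_sharpClosure_of_map_eq {h : G →ₜ* Y} {V : Set Y} {x : RaikovCompletion G} {y : Y}
    (hV : V ∈ 𝓝 y) (hx : map h x = of y) : x ∈ sharpClosure (h ⁻¹' V) := by
  obtain ⟨O, hO, hOV⟩ := mem_comap.1 (isEmbedding_of.isInducing.nhds_eq_comap y ▸ hV)
  have hcont : Continuous fun z : TopRaikov (Coreflection G) => map h (toSharp.symm z) :=
    (map_continuous (map h)).comp continuous_toSharp_symm
  refine mem_sharpClosure.2 (mem_closure_iff_nhds.2 fun T hT => ?_)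
  have hO' : (fun z => map h (toSharp.symm z)) ⁻¹' O ∈ 𝓝 (toSharp x) :=
    hcont.continuousAt.preimage_mem_nhds (by simpa [hx] using hO)
  obtain ⟨a, haT, haO⟩ := TopRaikov.isDenseInducing_of.dense.mem_nhds (inter_mem hT hO')
  refine ⟨_, haT, _, ⟨Coreflection.of.symm a, hOV ?_, rfl⟩, rfl⟩
  exact mem_preimage.2 (map_of h (Coreflection.of.symm a) ▸ haO)

end RaikovCompletion

/-- `𝒞` consists of homomorphisms defined on pseudocompact topological groups. -/
def HasPseudocompactDomains (C : ParaHomClass.{u, v}) : Prop :=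
  ∀ (X : Type v) (Y : Type u) [Group X] [TopologicalSpace X] [ParatopologicalGroup X]
    [Group Y] [TopologicalSpace Y] [ParatopologicalGroup Y] (h : X →ₜ* Y),
    h ∈ C X Y → IsTopologicalGroup X ∧ IsPseudocompact X

theorem HasPseudocompactDomains.cCompletion_le_extensionDomain {C : ParaHomClass.{u, v}}
    (hC : HasPseudocompactDomains C) {G Y : Type u} [Group G] [TopologicalSpace G]
    [ParatopologicalGroup G] [Group Y] [TopologicalSpace Y] [ParatopologicalGroup Y]
    (hY : IsGδ ({1} : Set Y)) (h : G →ₜ* Y) :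
    cCompletion C G ≤ RaikovCompletion.extensionDomain h :=
  sInf_le ⟨RaikovCompletion.range_of_le_extensionDomain h, fun X _ _ _ f hf =>
    have ⟨_, hX⟩ := hC X _ f hf
    RaikovCompletion.exists_extension_extensionDomain hX hY h f⟩

/-- `G` is *projectively `P`*: its topology at the identity is generated by continuous homomorphisms
to paratopological groups with the property `P`. -/
def IsProjectively (P : ∀ (Y : Type u) [Group Y] [TopologicalSpace Y], Prop) (G : Type u)
    [Group G] [TopologicalSpace G] : Prop :=
  ∀ U ∈ 𝓝 (1 : G), ∃ (Y : Type u) (_ : Group Y) (_ : TopologicalSpace Y)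
    (_ : ParatopologicalGroup Y) (h : G →ₜ* Y), P Y ∧ ∃ V ∈ 𝓝 (1 : Y), h ⁻¹' V ⊆ U

namespace IsProjectively

variable {P : ∀ (Y : Type u) [Group Y] [TopologicalSpace Y], Prop} {G : Type u} [Group G]
  [TopologicalSpace G]

theorem t2Space [ParatopologicalGroup G] (hG : IsProjectively P G)
    (hP : ∀ (Y : Type u) [Group Y] [TopologicalSpace Y], P Y → T2Space Y) : T2Space G := by
  refine t2_iff_nhds.2 fun {x y} hxy => ?_
  have hmap {Y : Type u} [Group Y] [TopologicalSpace Y] (hY : P Y) (h : G →ₜ* Y) : h x = h y :=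
    have := hP Y hY
    tendsto_nhds_unique (((map_continuous h).tendsto x).mono_left inf_le_left)
      (((map_continuous h).tendsto y).mono_left inf_le_right)
  have hmem (U) (hU : U ∈ 𝓝 (1 : G)) : x⁻¹ * y ∈ U ∧ y⁻¹ * x ∈ U := by
    obtain ⟨Y, _, _, _, h, hY, V, hV, hVU⟩ := hG U hU
    have := mem_of_mem_nhds hV
    constructor <;> exact hVU (by simpa [hmap hY h] using this)
  have hspec {a b : G} (hab : ∀ U ∈ 𝓝 (1 : G), a⁻¹ * b ∈ U) : b ⤳ a := by
    refine specializes_iff_pure.2 fun U hU => ?_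
    simpa using hab ((a * ·) ⁻¹' U)
      ((continuous_const_mul a).continuousAt.preimage_mem_nhds (by simpa using hU))
  exact ((hspec fun U hU => (hmem U hU).2).antisymm (hspec fun U hU => (hmem U hU).1)).eq

theorem cCompletion [ParatopologicalGroup G] {C : ParaHomClass.{u, v}}
    (hC : HasPseudocompactDomains C) (hG : IsProjectively P G)
    (hP : ∀ (Y : Type u) [Group Y] [TopologicalSpace Y], P Y → IsGδ ({1} : Set Y)) :
    IsProjectively P (cCompletion C G) := by
  intro U hU
  obtain ⟨U', hU', hU'U⟩ := mem_nhds_subtype _ _ _ |>.1 hU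
  obtain ⟨W, hW, hWU'⟩ := RaikovCompletion.mem_nhdsOne.1 (RaikovCompletion.nhds_one (G := G) ▸ hU')
  obtain ⟨Y, _, _, _, h, hY, V, hV, hVW⟩ := hG W hW
  obtain ⟨k, hk⟩ := RaikovCompletion.exists_of_comp_eq
    (φ := (RaikovCompletion.map h).comp
      ⟨(_root_.cCompletion C G).subtype, continuous_subtype_val⟩)
    fun x => hC.cCompletion_le_extensionDomain (hP Y hY) h x.2
  refine ⟨Y, _, _, ‹_›, k, hY, interior V, interior_mem_nhds.2 hV, fun x hx => hU'U (hWU' ?_)⟩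
  exact RaikovCompletion.sharpClosure_mono hVW <|
    RaikovCompletion.mem_sharpClosure_of_map_eq (mem_interior_iff_mem_nhds.1 hx) (hk x).symm

end IsProjectively

theorem continuousMul_quotient {G : Type u} [Group G] [TopologicalSpace G] [ContinuousMul G]
    (N : Subgroup G) [N.Normal] : ContinuousMul (G ⧸ N) where
  continuous_mul := by
    rw [← (QuotientGroup.isOpenQuotientMap_mk.prodMap
      QuotientGroup.isOpenQuotientMap_mk).continuous_comp_iff]
    exact QuotientGroup.continuous_mk.comp continuous_mul

theorem IsProjectivelyPsi.isProjectively {G : Type u} [Group G] [TopologicalSpace G]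
    [ContinuousMul G] (hG : IsProjectivelyPsi G) :
    IsProjectively (fun Y _ _ => T2Space Y ∧ IsGδ ({1} : Set Y)) G := by
  intro U hU
  obtain ⟨W, hW, hWU⟩ := exists_nhds_one_split hU
  obtain ⟨Y, _, _, _, h, hY, hYδ, hhW⟩ := hG W hW
  let N := h.toMonoidHom.ker
  let k : G ⧸ N →* Y := QuotientGroup.kerLift h.toMonoidHom
  have hk : Continuous k := (map_continuous h).quotient_lift _
  have hkinj : Function.Injective k := QuotientGroup.kerLift_injective _
  have hT2 : T2Space (G ⧸ N) := .of_injective_continuous hkinj hk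
  have hone : k ⁻¹' {1} = {1} := ext fun z => map_eq_one_iff k hkinj
  refine ⟨G ⧸ N, inferInstance, inferInstance,
    { toContinuousMul := continuousMul_quotient N, toT0Space := inferInstance },
    ⟨QuotientGroup.mk' N, QuotientGroup.continuous_mk⟩, ⟨hT2, hone ▸ (hYδ 1).preimage hk⟩,
    (↑) '' W, ?_, ?_⟩
  · exact QuotientGroup.nhds_eq N 1 ▸ image_mem_map hW
  · rintro x ⟨w, hw, hwx⟩
    have hker : w⁻¹ * x ∈ N := QuotientGroup.eq.1 hwx
    simpa using hWU w hw _ (hhW hker)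

section ContinuousMul

variable {G : Type u} [Group G] [TopologicalSpace G] [ContinuousMul G]

theorem neBot_nhds_inf_nhds_iff {x y : G} :
    NeBot (𝓝 x ⊓ 𝓝 y) ↔ ∀ V ∈ 𝓝 (1 : G), x⁻¹ * y ∈ V * V⁻¹ := by
  have hbasis (z : G) : (𝓝 z).HasBasis (· ∈ 𝓝 (1 : G)) ((z * ·) '' ·) :=
    map_const_mul_nhds_one z ▸ (𝓝 (1 : G)).basis_sets.map (z * ·)
  rw [(hbasis x).inf_basis_neBot_iff (hbasis y)]
  constructor
  · intro h V hV
    obtain ⟨_, ⟨v, hv, rfl⟩, w, hw, hvw⟩ := h hV hV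
    refine ⟨v, hv, w⁻¹, inv_mem_inv.2 hw, mul_inv_eq_iff_eq_mul.2 ?_⟩
    rw [mul_assoc, eq_inv_mul_iff_mul_eq]
    exact hvw.symm
  · intro h V hV W hW
    obtain ⟨v, hv, w, hw, hvw⟩ := h _ (inter_mem hV hW)
    refine ⟨x * v, ⟨v, hv.1, rfl⟩, w⁻¹, hw.2, mul_inv_eq_iff_eq_mul.2 ?_⟩
    rw [mul_assoc]
    exact inv_mul_eq_iff_eq_mul.1 hvw.symm

theorem t2Space_iff_forall_mem_mul_inv :
    T2Space G ↔ ∀ x : G, (∀ V ∈ 𝓝 (1 : G), x ∈ V * V⁻¹) → x = 1 := by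
  simp only [t2_iff_nhds, neBot_nhds_inf_nhds_iff]
  refine ⟨fun h x hx => (h (x := 1) (y := x) (by simpa using hx)).symm, fun h x y hxy => ?_⟩
  exact inv_mul_eq_one.1 (h _ hxy)

theorem hausdorffNumber_le_mk_iff [T2Space G] {ι : Type u} [Nonempty ι] :
    hausdorffNumber G ≤ #ι ↔ ∀ U ∈ 𝓝 (1 : G), ∃ V : ι → Set G,
      (∀ i, V i ∈ 𝓝 (1 : G)) ∧ (⋂ i, V i * (V i)⁻¹) ⊆ U := by
  constructor
  · intro h U hU
    -- `Hs(G)` is attained, because the family of all neighborhoods of the identity is admissible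
    have hne : {κ : Cardinal.{u} | 1 ≤ κ ∧ ∀ U ∈ 𝓝 (1 : G), ∃ V : κ.out → Set G,
        (∀ α, V α ∈ 𝓝 (1 : G)) ∧ (⋂ α, V α * (V α)⁻¹) ⊆ U}.Nonempty := by
      let N := {V : Set G // V ∈ 𝓝 1}
      have : Nonempty N := ⟨⟨univ, univ_mem⟩⟩
      refine ⟨#N, Cardinal.one_le_iff_ne_zero.2 (mk_ne_zero _), fun U hU =>
        ⟨fun α => (outMkEquiv (α := N) α).1, fun α => (outMkEquiv (α := N) α).2, fun x hx => ?_⟩⟩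
      rw [(outMkEquiv (α := N)).surjective.iInter_comp fun V => V.1 * V.1⁻¹] at hx
      rw [t2Space_iff_forall_mem_mul_inv.1 ‹_› x fun V hV => mem_iInter.1 hx ⟨V, hV⟩]
      exact mem_of_mem_nhds hU
    have hmem := csInf_mem hne
    rw [← hausdorffNumber] at hmem
    obtain ⟨hone, hκ⟩ := hmem
    obtain ⟨V, hV, hVU⟩ := hκ U hU
    have : Nonempty (hausdorffNumber G).out :=
      mk_ne_zero_iff.1 (by simpa [mk_out] using Cardinal.one_le_iff_ne_zero.1 hone)
    obtain ⟨e⟩ : Nonempty ((hausdorffNumber G).out ↪ ι) :=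
      (Cardinal.le_def _ _).1 ((mk_out _).trans_le h)
    have hs := Function.invFun_surjective e.injective
    exact ⟨V ∘ Function.invFun e, fun i => hV _,
      (hs.iInter_comp fun α => V α * (V α)⁻¹).trans_subset hVU⟩
  · intro h
    refine csInf_le' ⟨Cardinal.one_le_iff_ne_zero.2 (mk_ne_zero ι), fun U hU => ?_⟩
    obtain ⟨V, hV, hVU⟩ := h U hU
    exact ⟨V ∘ outMkEquiv, fun α => hV _,
      (outMkEquiv.surjective.iInter_comp fun i => V i * (V i)⁻¹).trans_subset hVU⟩

theorem hausdorffNumber_le_aleph0_iff [T2Space G] :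
    hausdorffNumber G ≤ ℵ₀ ↔ ∀ U ∈ 𝓝 (1 : G), ∃ V : ℕ → Set G,
      (∀ n, V n ∈ 𝓝 (1 : G)) ∧ (⋂ n, V n * (V n)⁻¹) ⊆ U := by
  rw [aleph0, ← mk_uLift, hausdorffNumber_le_mk_iff]
  refine forall₂_congr fun U _ => (Equiv.ulift.arrowCongr (Equiv.refl _)).exists_congr fun V => ?_
  simp [← Equiv.ulift.symm.surjective.iInter_comp]

end ContinuousMul

/-- `l` is compatible with the group structure: it is the neighborhood filter of the identity for a
topology on `G` with jointly continuous multiplication. -/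
structure IsNhdsOneFilter {G : Type u} [Group G] (l : Filter G) : Prop where
  pure_one_le : pure 1 ≤ l
  tendsto_mul : Tendsto (Function.uncurry ((· * ·) : G → G → G)) (l ×ˢ l) l
  tendsto_conj (x : G) : Tendsto (fun y => x * y * x⁻¹) l l

namespace IsNhdsOneFilter

variable {G : Type u} [Group G] {l : Filter G}

theorem exists_mul_mem (hl : IsNhdsOneFilter l) {U : Set G} (hU : U ∈ l) :
    ∃ V ∈ l, ∀ x ∈ V, ∀ y ∈ V, x * y ∈ U := by
  obtain ⟨V, hV, hVU⟩ := mem_prod_self_iff.1 (hl.tendsto_mul hU)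
  exact ⟨V, hV, fun x hx y hy => hVU (mk_mem_prod hx hy)⟩

theorem exists_topology (hl : IsNhdsOneFilter l) :
    ∃ (_ : TopologicalSpace G) (_ : ContinuousMul G), 𝓝 (1 : G) = l := by
  let _ : TopologicalSpace G := TopologicalSpace.mkOfNhds fun x => map (x * ·) l
  have hnhds (x : G) : 𝓝 x = map (x * ·) l := by
    refine TopologicalSpace.nhds_mkOfNhds _ x (fun a s hs => ?_) fun a s hs => ?_
    · simpa using hl.pure_one_le (mem_map.1 hs)
    · obtain ⟨V, hV, hVs⟩ := hl.exists_mul_mem (mem_map.1 hs)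
      refine mem_map.2 (mem_of_superset hV fun y hy => mem_map.2 (mem_of_superset hV ?_))
      exact fun z hz => by simpa [mul_assoc] using hVs y hy z hz
  have hone : 𝓝 (1 : G) = l := by simp [hnhds]
  refine ⟨_, .of_nhds_one (by rw [hone]; exact hl.tendsto_mul) (fun x => by rw [hone, hnhds])
    fun x => ?_, hone⟩
  rw [hone, hnhds]
  refine le_antisymm ?_ ?_
  · simpa [Function.comp_def, Tendsto] using (tendsto_map (f := (· * x))).comp (hl.tendsto_conj x)
  · simpa [Function.comp_def, Tendsto, mul_assoc] using
      (tendsto_map (f := (x * ·))).comp (hl.tendsto_conj x⁻¹)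

theorem map_of_surjective (hl : IsNhdsOneFilter l) {H : Type v} [Group H] {f : G →* H}
    (hf : Function.Surjective f) : IsNhdsOneFilter (map f l) where
  pure_one_le := by simpa using map_mono (m := f) hl.pure_one_le
  tendsto_mul := by
    rw [prod_map_map_eq, tendsto_map'_iff]
    exact (tendsto_map.comp hl.tendsto_mul).congr fun p => map_mul f p.1 p.2
  tendsto_conj := hf.forall.2 fun x => tendsto_map'_iff.2 <|
    (tendsto_map.comp (hl.tendsto_conj x)).congr fun y => by simp

/-- The intersection of the members of `l`, as a subgroup; it is closed under inversion when the
sets `V * V⁻¹` with `V ∈ l` have the same intersection. -/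
def kerSubgroup (hl : IsNhdsOneFilter l) (hsep : ∀ x, (∀ V ∈ l, x ∈ V * V⁻¹) → x ∈ l.ker) :
    Subgroup G where
  carrier := l.ker
  one_mem' := mem_ker.2 fun _ hU => hl.pure_one_le hU
  mul_mem' hx hy := mem_ker.2 fun _ hU => by
    obtain ⟨V, hV, hVU⟩ := hl.exists_mul_mem hU
    exact hVU _ (mem_ker.1 hx V hV) _ (mem_ker.1 hy V hV)
  inv_mem' hx := hsep _ fun V hV =>
    ⟨1, hl.pure_one_le hV, _, inv_mem_inv.2 (mem_ker.1 hx V hV), one_mul _⟩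

theorem normal_kerSubgroup (hl : IsNhdsOneFilter l)
    (hsep : ∀ x, (∀ V ∈ l, x ∈ V * V⁻¹) → x ∈ l.ker) : (hl.kerSubgroup hsep).Normal :=
  ⟨fun x hx g => mem_ker.2 fun _ hU =>
    mem_ker.1 (show x ∈ l.ker from hx) _ (hl.tendsto_conj g hU)⟩

theorem comap_map_mk (hl : IsNhdsOneFilter l)
    (hsep : ∀ x, (∀ V ∈ l, x ∈ V * V⁻¹) → x ∈ l.ker) :
    comap ((↑) : G → G ⧸ hl.kerSubgroup hsep) (map (↑) l) = l := by
  refine le_antisymm (fun U hU => ?_) le_comap_map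
  obtain ⟨V, hV, hVU⟩ := hl.exists_mul_mem hU
  refine ⟨_, image_mem_map hV, ?_⟩
  rintro x ⟨v, hv, hvx⟩
  have hker : v⁻¹ * x ∈ l.ker := QuotientGroup.eq.1 hvx
  simpa using hVU v hv _ (mem_ker.1 hker V hV)

theorem exists_hausdorff_quotient [l.IsCountablyGenerated] (hl : IsNhdsOneFilter l)
    (hsep : ∀ x, (∀ V ∈ l, x ∈ V * V⁻¹) → x ∈ l.ker) :
    ∃ (Y : Type u) (_ : Group Y) (_ : TopologicalSpace Y) (_ : ParatopologicalGroup Y)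
      (q : G →* Y), T2Space Y ∧ FirstCountableTopology Y ∧ comap q (𝓝 1) = l := by
  let N := hl.kerSubgroup hsep
  have : N.Normal := hl.normal_kerSubgroup hsep
  obtain ⟨_, _, hnhds⟩ :=
    (hl.map_of_surjective (QuotientGroup.mk'_surjective N)).exists_topology
  have hcomap : comap (QuotientGroup.mk' N) (𝓝 1) = l := hnhds ▸ hl.comap_map_mk hsep
  have hT2 : T2Space (G ⧸ N) := by
    refine t2Space_iff_forall_mem_mul_inv.2 fun y hy => ?_
    obtain ⟨x, rfl⟩ := QuotientGroup.mk'_surjective N y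
    refine (QuotientGroup.eq_one_iff x).2 (hsep x fun _ hU => ?_)
    obtain ⟨W, hW, hWU⟩ := mem_comap.1 (hcomap ▸ hU)
    obtain ⟨w, hw, z, hz, hwz⟩ := hy W hW
    obtain ⟨v, rfl⟩ := QuotientGroup.mk'_surjective N z
    refine ⟨x * v⁻¹, hWU ?_, v, hWU hz, inv_mul_cancel_right x v⟩
    rw [mem_preimage, map_mul, map_inv, ← hwz]
    simpa using hw
  have hfc : FirstCountableTopology (G ⧸ N) := ⟨fun y => by
    rw [← map_const_mul_nhds_one, hnhds]
    infer_instance⟩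
  exact ⟨G ⧸ N, _, _, {}, QuotientGroup.mk' N, hT2, hfc, hcomap⟩

end IsNhdsOneFilter

theorem exists_countable_subset_closed {α : Type*} {Φ : α → Set α} (hΦ : ∀ a, (Φ a).Countable)
    (a : α) : ∃ γ : Set α, γ.Countable ∧ a ∈ γ ∧ ∀ b ∈ γ, Φ b ⊆ γ := by
  let S (n : ℕ) : Set α := (fun s => ⋃ b ∈ s, Φ b)^[n] {a}
  have hS (n : ℕ) : S (n + 1) = ⋃ b ∈ S n, Φ b := Function.iterate_succ_apply' _ _ _
  have hcount (n : ℕ) : (S n).Countable := by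
    induction n with
    | zero => exact countable_singleton a
    | succ n ih => exact hS n ▸ ih.biUnion fun b _ => hΦ b
  refine ⟨⋃ n, S n, countable_iUnion hcount, mem_iUnion.2 ⟨0, rfl⟩, fun b hb c hc => ?_⟩
  obtain ⟨n, hn⟩ := mem_iUnion.1 hb
  exact mem_iUnion.2 ⟨n + 1, hS n ▸ mem_biUnion hn hc⟩

namespace IsOmegaBalanced

variable {G : Type u} [Group G] [TopologicalSpace G] [ContinuousMul G] [T2Space G]

theorem exists_countable_nhds_one (hG : IsOmegaBalanced G) (hHs : hausdorffNumber G ≤ ℵ₀)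
    (U : {U : Set G // U ∈ 𝓝 1}) : ∃ 𝒱 : Set {V : Set G // V ∈ 𝓝 1}, 𝒱.Countable ∧
      (∃ V ∈ 𝒱, ∀ x ∈ V.1, ∀ y ∈ V.1, x * y ∈ U.1) ∧
      (∀ x : G, ∃ V ∈ 𝒱, ∀ y ∈ V.1, x * y * x⁻¹ ∈ U.1) ∧
      ∀ x : G, (∀ V ∈ 𝒱, x ∈ V.1 * V.1⁻¹) → x ∈ U.1 := by
  obtain ⟨M, hM, hMU⟩ := exists_nhds_one_split U.2
  obtain ⟨𝒲, h𝒲c, h𝒲, h𝒲U⟩ := hG U U.2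
  obtain ⟨V, hV, hVU⟩ := hausdorffNumber_le_aleph0_iff.1 hHs U U.2
  refine ⟨insert ⟨M, hM⟩ (Subtype.val ⁻¹' 𝒲 ∪ range fun n => ⟨V n, hV n⟩),
    ((h𝒲c.preimage Subtype.val_injective).union (countable_range _)).insert _,
    ⟨_, mem_insert _ _, hMU⟩, fun x => ?_, fun x hx => hVU (mem_iInter.2 fun n => ?_)⟩
  · obtain ⟨W, hW, hWU⟩ := h𝒲U x
    exact ⟨⟨W, h𝒲 W hW⟩, .inr (.inl hW), image_subset_iff.1 hWU⟩
  · exact hx _ (.inr (.inr (mem_range_self n)))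

theorem exists_isNhdsOneFilter (hG : IsOmegaBalanced G) (hHs : hausdorffNumber G ≤ ℵ₀)
    {U : Set G} (hU : U ∈ 𝓝 (1 : G)) :
    ∃ l : Filter G, IsNhdsOneFilter l ∧ l.IsCountablyGenerated ∧ 𝓝 1 ≤ l ∧ U ∈ l ∧
      ∀ x, (∀ V ∈ l, x ∈ V * V⁻¹) → x ∈ l.ker := by
  choose Φ hΦ hmul hconj hsep using hG.exists_countable_nhds_one hHs
  obtain ⟨γ, hγ, hUγ, hΦγ⟩ := exists_countable_subset_closed hΦ ⟨U, hU⟩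
  have hgen {V} (hV : V ∈ γ) : V.1 ∈ generate (Subtype.val '' γ) :=
    mem_generate_of_mem (mem_image_of_mem _ hV)
  have htendsto {β : Type u} {f : β → G} {k : Filter β} (hf : ∀ V ∈ γ, f ⁻¹' V.1 ∈ k) :
      Tendsto f k (generate (Subtype.val '' γ)) :=
    le_generate_iff.2 (image_subset_iff.2 hf)
  have hle : 𝓝 1 ≤ generate (Subtype.val '' γ) :=
    le_generate_iff.2 (image_subset_iff.2 fun V _ => V.2)
  refine ⟨generate (Subtype.val '' γ), ⟨(pure_le_nhds 1).trans hle, ?_, fun x => ?_⟩,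
    ⟨_, hγ.image _, rfl⟩, hle, hgen hUγ, fun x hx => ?_⟩
  · refine htendsto fun V hV => ?_
    obtain ⟨M, hM, hMV⟩ := hmul V
    have hM' := hgen (hΦγ V hV hM)
    exact mem_of_superset (prod_mem_prod hM' hM') fun p hp => hMV _ hp.1 _ hp.2
  · refine htendsto fun V hV => ?_
    obtain ⟨W, hW, hWV⟩ := hconj V x
    exact mem_of_superset (hgen (hΦγ V hV hW)) hWV
  · have hpure : pure x ≤ generate (Subtype.val '' γ) :=
      le_generate_iff.2 (image_subset_iff.2 fun V hV =>
        hsep V x fun W hW => hx _ (hgen (hΦγ V hV hW)))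
    exact mem_ker.2 fun V hV => hpure hV

theorem isProjectively (hG : IsOmegaBalanced G) (hHs : hausdorffNumber G ≤ ℵ₀) :
    IsProjectively (fun Y _ _ => T2Space Y ∧ FirstCountableTopology Y) G := by
  intro U hU
  obtain ⟨l, hl, _, hle, hUl, hsep⟩ := hG.exists_isNhdsOneFilter hHs hU
  obtain ⟨Y, _, _, _, q, hT2, hfc, hq⟩ := hl.exists_hausdorff_quotient hsep
  have hcont : Continuous q := continuous_of_tendsto_one (tendsto_iff_comap.2 (hq ▸ hle))
  exact ⟨Y, _, _, ‹_›, ⟨q, hcont⟩, ⟨hT2, hfc⟩, mem_comap.1 (hq ▸ hUl)⟩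

end IsOmegaBalanced

namespace IsProjectively

variable {P : ∀ (Y : Type u) [Group Y] [TopologicalSpace Y], Prop} {G : Type u} [Group G]
  [TopologicalSpace G]

theorem isOmegaBalanced (hG : IsProjectively P G)
    (hP : ∀ (Y : Type u) [Group Y] [TopologicalSpace Y], P Y → FirstCountableTopology Y) :
    IsOmegaBalanced G := by
  intro U hU
  obtain ⟨Y, _, _, _, h, hY, V, hV, hVU⟩ := hG U hU
  have := hP Y hY
  obtain ⟨B, hB⟩ := (𝓝 (1 : Y)).exists_antitone_basis
  refine ⟨range fun n => h ⁻¹' B n, countable_range _, forall_mem_range.2 fun n => ?_, fun x => ?_⟩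
  · exact (map_continuous h).continuousAt.preimage_mem_nhds (by simpa using hB.mem n)
  · have hcont : Continuous fun y => h x * y * (h x)⁻¹ := by fun_prop
    obtain ⟨n, hn⟩ := hB.mem_iff.1 <|
      hcont.continuousAt.preimage_mem_nhds (x := 1) (by simpa using hV)
    refine ⟨_, mem_range_self n, image_subset_iff.2 fun v hv => hVU ?_⟩
    simpa using hn hv

theorem hausdorffNumber_le_aleph0 [ContinuousMul G] [T2Space G] (hG : IsProjectively P G)
    (hP : ∀ (Y : Type u) [Group Y] [TopologicalSpace Y], P Y →
      T2Space Y ∧ FirstCountableTopology Y) : hausdorffNumber G ≤ ℵ₀ := by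
  refine hausdorffNumber_le_aleph0_iff.2 fun U hU => ?_
  obtain ⟨Y, _, _, _, h, hY, V, hV, hVU⟩ := hG U hU
  obtain ⟨_, _⟩ := hP Y hY
  obtain ⟨B, hB⟩ := (𝓝 (1 : Y)).exists_antitone_basis
  refine ⟨fun n => h ⁻¹' B n, fun n => ?_, fun x hx => hVU ?_⟩
  · exact (map_continuous h).continuousAt.preimage_mem_nhds (by simpa using hB.mem n)
  · have hone : h x = 1 := by
      refine t2Space_iff_forall_mem_mul_inv.1 ‹_› _ fun W hW => ?_
      obtain ⟨n, hn⟩ := hB.mem_iff.1 hW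
      obtain ⟨a, ha, b, hb, rfl⟩ := mem_iInter.1 hx n
      exact ⟨h a, hn ha, h b, hn (by simpa using hb), (map_mul h a b).symm⟩
    exact mem_preimage.2 (hone ▸ mem_of_mem_nhds hV)

end IsProjectively

theorem theorem3p3 (C : ParaHomClass.{u, v})
    (hC : ∀ (X : Type v) (Y : Type u) [Group X] [TopologicalSpace X] [ParatopologicalGroup X]
      [Group Y] [TopologicalSpace Y] [ParatopologicalGroup Y] (h : X →ₜ* Y),
      h ∈ C X Y → IsTopologicalGroup X ∧ IsPseudocompact X)
    (G : Type u) [Group G] [TopologicalSpace G] [ParatopologicalGroup G] :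
    (IsProjectivelyPsi G → T2Space (cCompletion C G)) ∧
    (T2Space G → IsOmegaBalanced G → hausdorffNumber G ≤ ℵ₀ →
      IsOmegaBalanced (cCompletion C G) ∧ T2Space (cCompletion C G) ∧
        hausdorffNumber (cCompletion C G) ≤ ℵ₀) := by
  refine ⟨fun hG => ?_, fun hT2 hG hHs => ?_⟩
  · exact (hG.isProjectively.cCompletion hC fun _ _ _ hY => hY.2).t2Space fun _ _ _ hY => hY.1
  · have hcompl := (hG.isProjectively hHs).cCompletion hC fun Y _ _ ⟨_, _⟩ => IsGδ.singleton 1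
    have : T2Space (cCompletion C G) := hcompl.t2Space fun _ _ _ hY => hY.1
    exact ⟨hcompl.isOmegaBalanced fun _ _ _ hY => hY.2, this,
      hcompl.hausdorffNumber_le_aleph0 fun _ _ _ => id⟩
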